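/- Let $n \ge 3$ be an integer, let $H_n$ be the set of all $n \times n$ complex hermitian matrices, and let $\phi : H_n \to H_n$ be a bijective map such that for all $A, B \in H_n$ $$AB = BA \iff \phi(A)\phi(B) = \phi(B)\phi(A).$$ Then there exist an $n \times n$ unitary matrix $U$ and, for every $A \in H_n$, an injective real-valued function $f_A$ defined on the spectrum of $A$ such that either $$\phi(A) = U f_A(A) U^* \quad \text{for every } A \in H_n,$$ or $$\phi(A) = U f_A(A^t) U^* \quad \text{for every } A \in H_n.$$ Here $A^t$ is the transpose of $A$ (which is hermitian with the same spectrum as $A$), and $f(B)$ denotes the functional calculus: if $B = W \,\mathrm{diag}(d_1,\dots,d_n)\, W^*$ with $W$ unitary and $d_i$ real, then $f(B) = W \,\mathrm{diag}(f(d_1),\dots,f(d_n))\, W^*$. -/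

import Mathlib

open scoped Matrix

/-! For `v ≠ 0`, a hermitian matrix commutes with `v v*` exactly when `v` is an eigenvector of it,
so eigenvectors can be read off from commutation once rank one matrices are recognised. A commutant
corresponds to a decomposition into eigenspaces. Adjoining `v v*` to a matrix commuting with it only
splits the line of `v` off one eigenspace, so nothing lies strictly in between; among nonscalar
matrices this property (`AddsOneBlock`) characterises the commutants of rank one projections. Being
stated through commutation alone, it is preserved by `φ`.

Hence `φ` induces a map `ψ` of nonzero vectors such that `v` is an eigenvector of `A` iff `ψ v` is
one of `φ A`. Orthogonality means commuting rank one matrices on distinct lines, so `ψ` preserves it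
both ways and Uhlhorn's theorem makes `ψ` unitary or antiunitary up to scalars. After undoing `U`,
`φ A` has the eigenvectors of `A` or of `Aᵀ`, and hermitian matrices with the same eigenvectors are
injective functions of each other. -/

/-! ### Orthogonality-preserving maps of vectors -/

theorem ringHom_eq_id_or_conj (σ : ℂ →+* ℂ) (hσ : ∀ z, σ (star z) = star (σ z)) :
    (∀ z, σ z = z) ∨ (∀ z, σ z = star z) := by
  have him : ∀ r : ℝ, ((σ r).re : ℂ) = σ r := fun r => by
    have h := hσ (r : ℂ)
    rw [Complex.star_def, Complex.conj_ofReal] at h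
    exact (Complex.conj_eq_iff_re.1 h.symm)
  -- By `hσ`, `σ` maps reals to reals. The identity is the only ring endomorphism of `ℝ`, so `σ` is
  -- `ℝ`-linear.
  let τ : ℝ →+* ℝ :=
    { toFun := fun r => (σ r).re
      map_one' := by simp
      map_zero' := by simp
      map_add' := fun x y => by simp
      map_mul' := fun x y => by
        apply Complex.ofReal_injective
        push_cast
        rw [him, him]
        have := him (x * y)
        push_cast at this
        rw [this, map_mul] }
  have hτ : ∀ r : ℝ, σ r = r := fun r => by
    have h : τ r = r := by rw [Subsingleton.elim τ (RingHom.id ℝ)]; rfl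
    rw [← him r]
    exact congrArg _ h
  let α : ℂ →ₐ[ℝ] ℂ := { σ with commutes' := fun r => by simpa using hτ r }
  rcases Complex.real_algHom_eq_id_or_conj α with h | h
  · exact Or.inl fun z => DFunLike.congr_fun h z
  · exact Or.inr fun z => DFunLike.congr_fun h z

section Coordinates

variable {ι : Type*} [Fintype ι]

open scoped ComplexOrder in
theorem exists_star_dotProduct_self_eq {v : ι → ℂ} (hv : v ≠ 0) :
    ∃ N : ℝ, 0 < N ∧ star v ⬝ᵥ v = N := by
  have h := Complex.pos_iff.1 (Matrix.dotProduct_star_self_pos_iff.2 hv)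
  exact ⟨_, h.1, Complex.ext rfl h.2.symm⟩

theorem star_dotProduct_self_ne_zero {v : ι → ℂ} (hv : v ≠ 0) : star v ⬝ᵥ v ≠ 0 := by
  obtain ⟨N, hN, h⟩ := exists_star_dotProduct_self_eq hv
  rw [h]
  exact_mod_cast hN.ne'

variable [DecidableEq ι]

theorem dotProduct_eq_add_of_support_pair {i j : ι} (hij : i ≠ j) (v w : ι → ℂ)
    (h : ∀ k, k ≠ i → k ≠ j → v k = 0) : v ⬝ᵥ w = v i * w i + v j * w j := by
  have h1 : ∑ k ∈ {i, j}, v k * w k = v i * w i + v j * w j := Finset.sum_pair hij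
  rw [dotProduct, ← h1]
  refine (Finset.sum_subset (Finset.subset_univ _) fun k _ hk => ?_).symm
  simp only [Finset.mem_insert, Finset.mem_singleton, not_or] at hk
  simp [h k hk.1 hk.2]

theorem dotProduct_eq_add_of_support_triple {a b c : ι} (hab : a ≠ b) (hac : a ≠ c) (hbc : b ≠ c)
    (v w : ι → ℂ) (h : ∀ k, k ≠ a → k ≠ b → k ≠ c → v k = 0) :
    v ⬝ᵥ w = v a * w a + v b * w b + v c * w c := by
  have h1 : ∑ k ∈ {a, b, c}, v k * w k = v a * w a + v b * w b + v c * w c := by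
    rw [Finset.sum_insert (by simp [hab, hac]), Finset.sum_pair hbc, add_assoc]
  rw [dotProduct, ← h1]
  refine (Finset.sum_subset (Finset.subset_univ _) fun k _ hk => ?_).symm
  simp only [Finset.mem_insert, Finset.mem_singleton, not_or] at hk
  simp [h k hk.1 hk.2.1 hk.2.2]

/-- If a map of nonzero vectors preserves orthogonality and the coordinate hyperplanes, then the
ratio of two coordinates of the image depends only on the ratio of these coordinates. -/
theorem exists_ratio_map (χ : (ι → ℂ) → ι → ℂ)
    (h0 : ∀ x, x ≠ 0 → ∀ i, χ x i = 0 ↔ x i = 0)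
    (h1 : ∀ x y, x ≠ 0 → y ≠ 0 → star x ⬝ᵥ y = 0 → star (χ x) ⬝ᵥ χ y = 0)
    {i j : ι} (hij : i ≠ j) (t : ℂ) :
    ∃ s : ℂ, ∀ x, x i ≠ 0 → x j = t * x i → χ x j = s * χ x i := by
  -- `w` is orthogonal to every `x` with `x j = t * x i`, and `χ w` is again supported on `{i, j}`,
  -- so one linear relation fixes the ratio.
  let w : ι → ℂ := fun k => if k = i then -star t else if k = j then 1 else 0
  have hwi : w i = -star t := by simp [w]
  have hwj : w j = 1 := by simp [w, hij.symm]
  have hwk : ∀ k, k ≠ i → k ≠ j → w k = 0 := fun k hi hj => by simp [w, hi, hj]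
  have hw : w ≠ 0 := fun h => by simp [h] at hwj
  have hχj : χ w j ≠ 0 := by rw [Ne, h0 w hw, hwj]; exact one_ne_zero
  refine ⟨-star (χ w i) / star (χ w j), fun x hxi hx => ?_⟩
  have hx0 : x ≠ 0 := fun h => hxi (by simp [h])
  have h := h1 w x hw hx0 (by
    rw [dotProduct_eq_add_of_support_pair hij _ _ fun k hi hj => by simp [hwk k hi hj]]
    simp [hwi, hwj, hx])
  rw [dotProduct_eq_add_of_support_pair hij _ _ fun k hi hj => by
    simp [(h0 w hw k).2 (hwk k hi hj)]] at h
  have hs : star (χ w j) ≠ 0 := star_ne_zero.2 hχj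
  simp only [Pi.star_apply] at h
  field_simp
  linear_combination h

/-- A map of nonzero vectors of `ℂ^ι`, `3 ≤ |ι|`, which preserves orthogonality and the coordinate
hyperplanes is, up to scalars, a diagonal map composed with the identity or with conjugation. -/
theorem exists_diagonal_of_orthogonality_preserving {a b c : ι} (hab : a ≠ b) (hac : a ≠ c)
    (hbc : b ≠ c) (χ : (ι → ℂ) → ι → ℂ)
    (h0 : ∀ x, x ≠ 0 → ∀ i, χ x i = 0 ↔ x i = 0)
    (h1 : ∀ x y, x ≠ 0 → y ≠ 0 → star x ⬝ᵥ y = 0 → star (χ x) ⬝ᵥ χ y = 0) :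
    ∃ (d : ι → ℂ) (r : ℝ), 0 < r ∧ (∀ i, star (d i) * d i = r) ∧
      ((∀ x, x ≠ 0 → ∃ k : ℂ, k ≠ 0 ∧ ∀ i, χ x i = k * (d i * x i)) ∨
       (∀ x, x ≠ 0 → ∃ k : ℂ, k ≠ 0 ∧ ∀ i, χ x i = k * (d i * star (x i)))) := by
  have hne : ∀ (x : ι → ℂ) (i : ι), x i ≠ 0 → x ≠ 0 := fun x i hi h => hi (by simp [h])
  have hχ : ∀ (x : ι → ℂ) (i : ι), x i ≠ 0 → χ x i ≠ 0 := fun x i hi =>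
    fun h => hi ((h0 x (hne x i hi) i).1 h)
  -- Dividing by the image of the all-ones vector normalises the ratio maps to send `1` to `1`.
  obtain ⟨d, hd⟩ : ∃ d, d = χ (fun _ => 1) := ⟨_, rfl⟩
  have hd0 : ∀ i, d i ≠ 0 := fun i => by rw [hd]; exact hχ _ i one_ne_zero
  have key : ∀ i j, i ≠ j → ∀ t, ∃ s : ℂ,
      ∀ x, x i ≠ 0 → x j = t * x i → χ x j / d j = s * (χ x i / d i) := by
    intro i j hij t
    obtain ⟨s, hs⟩ := exists_ratio_map χ h0 h1 hij t
    refine ⟨s * d i / d j, fun x hx hx' => ?_⟩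
    have := hd0 i
    have := hd0 j
    rw [hs x hx hx']
    field_simp
  choose! H hH using key
  have hH1 : ∀ i j, i ≠ j → H i j 1 = 1 := fun i j hij => by
    have h := hH i j hij 1 (fun _ => 1) one_ne_zero (by simp)
    rw [← hd, div_self (hd0 i), div_self (hd0 j), mul_one] at h
    exact h.symm
  have hH0 : ∀ i j, i ≠ j → H i j 0 = 0 := fun i j hij => by
    have hx : (Pi.single i 1 : ι → ℂ) i ≠ 0 := by simp
    have h := hH i j hij 0 (Pi.single i 1) hx (by simp [hij.symm])
    rw [(h0 _ (hne _ i hx) j).2 (by simp [hij.symm]), zero_div] at h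
    have h' := div_ne_zero (hχ _ i hx) (hd0 i)
    exact (mul_eq_zero.1 h.symm).resolve_right h'
  -- Equal coordinates have equal normalised images; vectors with two values then show that `H i j`
  -- depends on neither index.
  have hHa : ∀ i j k, i ≠ j → i ≠ k → H i j = H i k := by
    intro i j k hij hik
    by_cases hjk : j = k
    · rw [hjk]
    funext t
    by_cases ht : t = 0
    · rw [ht, hH0 i j hij, hH0 i k hik]
    let x : ι → ℂ := fun m => if m = j ∨ m = k then t else 1
    have xi : x i = 1 := by simp [x, hij, hik]
    have xj : x j = t := by simp [x]
    have xk : x k = t := by simp [x]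
    have e1 := hH i j hij t x (by simp [xi]) (by simp [xi, xj])
    have e2 := hH i k hik t x (by simp [xi]) (by simp [xi, xk])
    have e3 := hH j k hjk 1 x (by simp [xj, ht]) (by simp [xj, xk])
    rw [hH1 j k hjk, one_mul, e1, e2] at e3
    exact (mul_right_cancel₀ (div_ne_zero (hχ x i (by simp [xi])) (hd0 i)) e3).symm
  have hHb : ∀ i j k, i ≠ k → j ≠ k → H i k = H j k := by
    intro i j k hik hjk
    by_cases hij : i = j
    · rw [hij]
    funext t
    let x : ι → ℂ := fun m => if m = k then t else 1
    have xi : x i = 1 := by simp [x, hik]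
    have xj : x j = 1 := by simp [x, hjk]
    have xk : x k = t := by simp [x]
    have e1 := hH i k hik t x (by simp [xi]) (by simp [xi, xk])
    have e2 := hH j k hjk t x (by simp [xj]) (by simp [xj, xk])
    have e3 := hH i j hij 1 x (by simp [xi]) (by simp [xi, xj])
    rw [hH1 i j hij, one_mul] at e3
    rw [e3, e1] at e2
    exact mul_right_cancel₀ (div_ne_zero (hχ x i (by simp [xi])) (hd0 i)) e2
  obtain ⟨h, hh⟩ : ∃ h, h = H a b := ⟨_, rfl⟩
  have hHh : ∀ i j, i ≠ j → H i j = h := by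
    have ha : ∀ j, a ≠ j → H a j = h := fun j hj => by rw [hh]; exact hHa a j b hj hab
    intro i j hij
    by_cases hja : a = j
    · subst hja
      by_cases hib : b = i
      · subst hib
        rw [hHa b a c hij hbc, hHb b a c hbc hac, ha c hac]
      · rw [hHa i a b hij (Ne.symm hib), hHb i a b (Ne.symm hib) hab, ha b hab]
    · rw [hHb i a j hij hja, ha j hja]
  have hX : ∀ i j, i ≠ j → ∀ t x, x i ≠ 0 → x j = t * x i →
      χ x j / d j = h t * (χ x i / d i) := fun i j hij t x => by
    rw [← hHh i j hij]; exact hH i j hij t x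
  have h_one : h 1 = 1 := by rw [hh, hH1 a b hab]
  have h_zero : h 0 = 0 := by rw [hh, hH0 a b hab]
  have h_mul : ∀ t s, h (t * s) = h t * h s := by
    intro t s
    by_cases ht : t = 0
    · simp [ht, h_zero]
    let x : ι → ℂ := fun m => if m = b then t else if m = c then s * t else 1
    have xa : x a = 1 := by simp [x, hab, hac]
    have xb : x b = t := by simp [x]
    have xc : x c = s * t := by simp [x, hbc.symm]
    have e1 := hX a b hab t x (by simp [xa]) (by simp [xa, xb])
    have e2 := hX b c hbc s x (by simp [xb, ht]) (by simp [xb, xc])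
    have e3 := hX a c hac (t * s) x (by simp [xa]) (by simp [xa, xc, mul_comm])
    rw [e3, e1, ← mul_assoc, mul_comm (h s)] at e2
    exact mul_right_cancel₀ (div_ne_zero (hχ x a (by simp [xa])) (hd0 a)) e2
  -- From `e_i + e_j ⟂ e_i - e_j`. Exchanging `i` and `j` and eliminating `h (-1)` will show that
  -- all `‖d i‖` agree.
  have hr : ∀ i j, i ≠ j → star (d i) * d i + star (d j) * d j * h (-1) = 0 := by
    intro i j hij
    let x : ι → ℂ := fun m => if m = i then 1 else if m = j then 1 else 0
    let y : ι → ℂ := fun m => if m = i then 1 else if m = j then -1 else 0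
    have xi : x i = 1 := by simp [x]
    have xj : x j = 1 := by simp [x]
    have xk : ∀ k, k ≠ i → k ≠ j → x k = 0 := fun k h1 h2 => by simp [x, h1, h2]
    have yi : y i = 1 := by simp [y]
    have yj : y j = -1 := by simp [y, hij.symm]
    have hx0 : x ≠ 0 := hne x i (by simp [xi])
    have hy0 : y ≠ 0 := hne y i (by simp [yi])
    have e1 := hX i j hij 1 x (by simp [xi]) (by simp [xi, xj])
    have e2 := hX i j hij (-1) y (by simp [yi]) (by simp [yi, yj])
    have e3 := h1 x y hx0 hy0 (by
      rw [dotProduct_eq_add_of_support_pair hij _ _ fun k h1 h2 => by simp [xk k h1 h2]]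
      simp [xi, xj, yi, yj])
    rw [dotProduct_eq_add_of_support_pair hij _ _ fun k h1 h2 => by
      simp [(h0 x hx0 k).2 (xk k h1 h2)]] at e3
    simp only [Pi.star_apply] at e3
    rw [h_one, one_mul, div_eq_iff (hd0 j)] at e1
    rw [div_eq_iff (hd0 j)] at e2
    have hxi : χ x i = χ x i / d i * d i := by field_simp [hd0 i]
    have hyi : χ y i = χ y i / d i * d i := by field_simp [hd0 i]
    have px := div_ne_zero (hχ x i (by simp [xi])) (hd0 i)
    have py := div_ne_zero (hχ y i (by simp [yi])) (hd0 i)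
    generalize χ x i / d i = p at *
    generalize χ y i / d i = q at *
    rw [e1, e2, hxi, hyi, star_mul', star_mul'] at e3
    refine mul_left_cancel₀ (mul_ne_zero (star_ne_zero.2 px) py) ?_
    linear_combination e3
  have hdn : ∀ i, star (d i) * d i = ((‖d i‖ ^ 2 : ℝ) : ℂ) := fun i => by
    rw [Complex.star_def, Complex.conj_mul']; norm_cast
  have hpos : ∀ i, 0 < ‖d i‖ ^ 2 := fun i => by have := norm_pos_iff.2 (hd0 i); positivity
  have hrr : ∀ i j, ‖d i‖ ^ 2 = ‖d j‖ ^ 2 := by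
    intro i j
    by_cases hij : i = j
    · rw [hij]
    have e1 := hr i j hij
    have e2 := hr j i (Ne.symm hij)
    rw [hdn, hdn] at e1 e2
    have e3 : (((‖d i‖ ^ 2) * ‖d i‖ ^ 2 : ℝ) : ℂ) = ((‖d j‖ ^ 2 * ‖d j‖ ^ 2 : ℝ) : ℂ) := by
      push_cast at e1 e2 ⊢
      linear_combination (‖d i‖ : ℂ) ^ 2 * e1 - (‖d j‖ : ℂ) ^ 2 * e2
    have e4 : ‖d i‖ ^ 2 * ‖d i‖ ^ 2 = ‖d j‖ ^ 2 * ‖d j‖ ^ 2 := by exact_mod_cast e3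
    have := hpos i
    have := hpos j
    nlinarith
  obtain ⟨r, hrdef⟩ : ∃ r, r = ‖d a‖ ^ 2 := ⟨_, rfl⟩
  have hr0 : 0 < r := hrdef ▸ hpos a
  have hdr : ∀ i, star (d i) * d i = r := fun i => by rw [hdn, hrr i a, hrdef]
  have hrC : (r : ℂ) ≠ 0 := by exact_mod_cast hr0.ne'
  have h_neg_one : h (-1) = -1 := by
    have e := hr a b hab
    rw [hdr, hdr] at e
    refine mul_left_cancel₀ hrC ?_
    linear_combination e
  have h_neg : ∀ t, h (-t) = -h t := fun t => by
    rw [← neg_one_mul, h_mul, h_neg_one, neg_one_mul]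
  -- From `(1, t, s) ⟂ (-star (t + s), 1, 1)`. The case `s = 0` gives compatibility with `star`, and
  -- then additivity.
  have h_add' : ∀ t s, h t + h s = star (h (star (t + s))) := by
    intro t s
    let x : ι → ℂ := fun m => if m = a then 1 else if m = b then t else if m = c then s else 0
    let y : ι → ℂ := fun m =>
      if m = a then -star (t + s) else if m = b then 1 else if m = c then 1 else 0
    have xa : x a = 1 := by simp [x]
    have xb : x b = t := by simp [x, hab.symm]
    have xc : x c = s := by simp [x, hac.symm, hbc.symm]
    have ya : y a = -star (t + s) := by simp [y]
    have yb : y b = 1 := by simp [y, hab.symm]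
    have yc : y c = 1 := by simp [y, hac.symm]
    have yk : ∀ k, k ≠ a → k ≠ b → k ≠ c → y k = 0 := fun k h1 h2 h3 => by simp [y, h1, h2, h3]
    have hx0 : x ≠ 0 := hne x a (by simp [xa])
    have hy0 : y ≠ 0 := hne y b (by simp [yb])
    have e1 := hX a b hab t x (by simp [xa]) (by simp [xa, xb])
    have e2 := hX a c hac s x (by simp [xa]) (by simp [xa, xc])
    have e3 := hX b a hab.symm (-star (t + s)) y (by simp [yb]) (by simp [ya, yb])
    have e4 := hX b c hbc 1 y (by simp [yb]) (by simp [yc, yb])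
    have e5 := h1 y x hy0 hx0 (by
      rw [dotProduct_eq_add_of_support_triple hab hac hbc _ _ fun k h1 h2 h3 => by
        simp [yk k h1 h2 h3]]
      simp [xa, xb, xc, ya, yb, yc])
    rw [dotProduct_eq_add_of_support_triple hab hac hbc _ _ fun k h1 h2 h3 => by
      simp [(h0 y hy0 k).2 (yk k h1 h2 h3)]] at e5
    simp only [Pi.star_apply] at e5
    rw [div_eq_iff (hd0 b)] at e1
    rw [div_eq_iff (hd0 c)] at e2 e4
    rw [div_eq_iff (hd0 a), h_neg] at e3
    rw [h_one, one_mul] at e4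
    have hxa : χ x a = χ x a / d a * d a := by field_simp [hd0 a]
    have hyb : χ y b = χ y b / d b * d b := by field_simp [hd0 b]
    have px := div_ne_zero (hχ x a (by simp [xa])) (hd0 a)
    have py := div_ne_zero (hχ y b (by simp [yb])) (hd0 b)
    generalize χ x a / d a = p at *
    generalize χ y b / d b = q at *
    rw [e1, e2, e3, e4, hxa, hyb] at e5
    simp only [star_mul', star_neg] at e5
    refine mul_left_cancel₀ (mul_ne_zero (mul_ne_zero (star_ne_zero.2 py) px) hrC) ?_
    have ra := hdr a
    have rb := hdr b
    have rc := hdr c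
    linear_combination e5 - star q * p * h t * rb - star q * p * h s * rc +
      star q * p * star (h (star (t + s))) * ra
  have h_star' : ∀ t, h t = star (h (star t)) := fun t => by
    have e := h_add' t 0
    rwa [h_zero, add_zero, add_zero] at e
  let σ : ℂ →+* ℂ :=
    { toFun := h
      map_one' := h_one
      map_zero' := h_zero
      map_add' := fun t s => by rw [h_add', ← h_star']
      map_mul' := h_mul }
  have hσ : (∀ z, h z = z) ∨ (∀ z, h z = star z) :=
    ringHom_eq_id_or_conj σ fun z => by
      change h (star z) = star (h z)
      rw [h_star' (star z), star_star]
  have hfin : ∀ x, x ≠ 0 → ∃ k : ℂ, k ≠ 0 ∧ ∀ i, χ x i = k * (d i * h (x i)) := by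
    intro x hx
    obtain ⟨i, hi⟩ := Function.ne_iff.1 hx
    simp only [Pi.zero_apply] at hi
    have hhi : h (x i) ≠ 0 := fun e => by
      have := h_mul (x i) (x i)⁻¹
      rw [mul_inv_cancel₀ hi, h_one, e, zero_mul] at this
      exact one_ne_zero this
    refine ⟨χ x i / d i / h (x i), div_ne_zero (div_ne_zero (hχ x i hi) (hd0 i)) hhi, fun j => ?_⟩
    by_cases hij : i = j
    · subst hij
      have := hd0 i
      field_simp
    have e := hX i j hij (x j / x i) x hi (by field_simp)
    have e2 : h (x j) = h (x j / x i) * h (x i) := by rw [← h_mul]; congr 1; field_simp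
    rw [div_eq_iff (hd0 j)] at e
    rw [e, e2]
    field_simp
  refine ⟨d, r, hr0, hdr, ?_⟩
  rcases hσ with hσ | hσ
  · exact Or.inl (by simpa only [hσ] using hfin)
  · exact Or.inr (by simpa only [hσ] using hfin)

/-- **Uhlhorn's theorem** in dimension at least three: a map of nonzero vectors that preserves
orthogonality in both directions is induced by a unitary or an antiunitary operator. -/
theorem exists_unitary_of_orthogonality_preserving {a b c : ι} (hab : a ≠ b) (hac : a ≠ c)
    (hbc : b ≠ c) (ψ : (ι → ℂ) → ι → ℂ) (hψ : ∀ x, x ≠ 0 → ψ x ≠ 0)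
    (horth : ∀ x y, x ≠ 0 → y ≠ 0 → (star x ⬝ᵥ y = 0 ↔ star (ψ x) ⬝ᵥ ψ y = 0)) :
    ∃ U ∈ Matrix.unitaryGroup ι ℂ,
      (∀ x, x ≠ 0 → ∃ k : ℂ, k ≠ 0 ∧ ψ x = k • (U *ᵥ x)) ∨
      (∀ x, x ≠ 0 → ∃ k : ℂ, k ≠ 0 ∧ ψ x = k • (U *ᵥ star x)) := by
  let e : ι → ι → ℂ := fun i => Pi.single i 1
  have he : ∀ i, e i ≠ 0 := fun i h => by simpa [e] using congrFun h i
  have hex : ∀ i (x : ι → ℂ), star (e i) ⬝ᵥ x = x i := fun i x => by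
    simp [e]
  have hs : ∀ i, ∃ s : ℝ, 0 < s ∧ (s : ℂ) * s * (star (ψ (e i)) ⬝ᵥ ψ (e i)) = 1 := by
    intro i
    obtain ⟨N, hN, hN'⟩ : ∃ N : ℝ, 0 < N ∧ star (ψ (e i)) ⬝ᵥ ψ (e i) = N :=
      exists_star_dotProduct_self_eq (hψ _ (he i))
    refine ⟨(√N)⁻¹, by positivity, ?_⟩
    rw [hN', ← Complex.ofReal_mul, ← Complex.ofReal_mul, ← mul_inv, Real.mul_self_sqrt hN.le,
      inv_mul_cancel₀ hN.ne', Complex.ofReal_one]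
  choose s hs0 hs1 using hs
  have hsC : ∀ i, (s i : ℂ) ≠ 0 := fun i => by exact_mod_cast (hs0 i).ne'
  -- The normalised images of the standard basis form an orthonormal basis. In its coordinates `ψ`
  -- preserves the coordinate hyperplanes, which are the orthogonal complements of the `e i`.
  let V : Matrix ι ι ℂ := Matrix.of fun i j => s j * ψ (e j) i
  have hVx : ∀ (x : ι → ℂ) i, (Vᴴ *ᵥ x) i = s i * (star (ψ (e i)) ⬝ᵥ x) := fun x i => by
    simp [V, Matrix.mulVec, dotProduct, Finset.mul_sum, mul_assoc]
  have hVV : Vᴴ * V = 1 := by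
    ext i j
    have h : (Vᴴ * V) i j = (Vᴴ *ᵥ fun k => V k j) i := rfl
    have h' : (fun k => V k j) = (s j : ℂ) • ψ (e j) := rfl
    rw [h, hVx, h', dotProduct_smul, smul_eq_mul]
    by_cases hij : i = j
    · subst hij
      rw [Matrix.one_apply_eq, ← hs1 i, mul_assoc]
    · rw [Matrix.one_apply_ne hij, (horth _ _ (he i) (he j)).1 (by rw [hex]; simp [e, hij]),
        mul_zero, mul_zero]
  have hVV' : V * Vᴴ = 1 := mul_eq_one_comm.1 hVV
  obtain ⟨d, r, hr, hd, h⟩ := exists_diagonal_of_orthogonality_preserving hab hac hbc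
    (fun x => Vᴴ *ᵥ ψ x)
    (fun x hx i => by
      rw [hVx, mul_eq_zero, or_iff_right (hsC i), ← horth _ _ (he i) hx, hex])
    (fun x y hx hy hxy => by
      rw [Matrix.star_mulVec, Matrix.conjTranspose_conjTranspose, ← Matrix.dotProduct_mulVec,
        Matrix.mulVec_mulVec, hVV', Matrix.one_mulVec]
      exact (horth x y hx hy).1 hxy)
  have hrC : ((√r : ℝ) : ℂ) ≠ 0 := by exact_mod_cast (Real.sqrt_pos.2 hr).ne'
  have hrr : ((√r : ℝ) : ℂ) * (√r : ℝ) = r := by exact_mod_cast Real.mul_self_sqrt hr.le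
  let D : Matrix ι ι ℂ := Matrix.diagonal fun i => d i / (√r : ℝ)
  have hDD : D * Dᴴ = 1 := by
    rw [Matrix.diagonal_conjTranspose, Matrix.diagonal_mul_diagonal, ← Matrix.diagonal_one]
    congr 1
    funext i
    have h2 : star ((√r : ℝ) : ℂ) = (√r : ℝ) := Complex.conj_ofReal _
    rw [Pi.star_apply, star_div₀, h2, div_mul_div_comm, mul_comm (d i), hd, hrr,
      div_self (by exact_mod_cast hr.ne')]
  have hfin : ∀ (x y : ι → ℂ) (k : ℂ), (∀ i, (Vᴴ *ᵥ ψ x) i = k * (d i * y i)) →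
      ψ x = (k * (√r : ℝ)) • ((V * D) *ᵥ y) := by
    intro x y k hk
    have h2 : Vᴴ *ᵥ ψ x = (k * (√r : ℝ)) • (D *ᵥ y) := by
      funext i
      rw [hk, Pi.smul_apply, Matrix.mulVec_diagonal, smul_eq_mul]
      field_simp
    rw [← Matrix.mulVec_mulVec, ← Matrix.mulVec_smul, ← h2, Matrix.mulVec_mulVec, hVV',
      Matrix.one_mulVec]
  refine ⟨V * D, Matrix.mem_unitaryGroup_iff.2 ?_, ?_⟩
  · rw [Matrix.star_eq_conjTranspose, Matrix.conjTranspose_mul, Matrix.mul_assoc,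
      ← Matrix.mul_assoc D, hDD, Matrix.one_mul, hVV']
  · refine h.imp (fun h x hx => ?_) fun h x hx => ?_
    · obtain ⟨k, hk, h⟩ := h x hx
      exact ⟨_, mul_ne_zero hk hrC, hfin x x k h⟩
    · obtain ⟨k, hk, h⟩ := h x hx
      exact ⟨_, mul_ne_zero hk hrC, hfin x (star x) k h⟩

end Coordinates

/-! ### Eigenvectors, commutants and functional calculus -/

theorem isHermitian_vecMulVec_star {ι : Type*} (v : ι → ℂ) :
    (Matrix.vecMulVec v (star v)).IsHermitian := by
  rw [Matrix.IsHermitian, Matrix.conjTranspose_vecMulVec, star_star]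

section Eigenvectors

variable {ι : Type*} [Fintype ι]

/-- `v` is zero or an eigenvector of `A`. -/
def IsEigenvector (A : Matrix ι ι ℂ) (v : ι → ℂ) : Prop := ∃ c : ℂ, A *ᵥ v = c • v

theorem isEigenvector_smul_iff (A : Matrix ι ι ℂ) (v : ι → ℂ) {k : ℂ} (hk : k ≠ 0) :
    IsEigenvector A (k • v) ↔ IsEigenvector A v := by
  refine exists_congr fun c => ?_
  rw [Matrix.mulVec_smul, smul_comm c k]
  exact (smul_right_injective _ hk).eq_iff

theorem IsEigenvector.zero (A : Matrix ι ι ℂ) : IsEigenvector A 0 := ⟨0, by simp⟩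

theorem Matrix.IsHermitian.star_dotProduct_mulVec {A : Matrix ι ι ℂ} (hA : A.IsHermitian)
    (v w : ι → ℂ) : star v ⬝ᵥ (A *ᵥ w) = star (A *ᵥ v) ⬝ᵥ w := by
  rw [Matrix.star_mulVec, hA.eq, ← Matrix.dotProduct_mulVec]

theorem Matrix.IsHermitian.star_eq_of_mulVec_eq_smul {A : Matrix ι ι ℂ} (hA : A.IsHermitian)
    {v : ι → ℂ} (hv : v ≠ 0) {c : ℂ} (h : A *ᵥ v = c • v) : star c = c := by
  have e := hA.star_dotProduct_mulVec v v
  rw [h, star_smul, dotProduct_smul, smul_dotProduct] at e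
  exact (mul_right_cancel₀ (star_dotProduct_self_ne_zero hv) e).symm

theorem vecMulVec_star_mulVec (v w : ι → ℂ) :
    Matrix.vecMulVec v (star v) *ᵥ w = (star v ⬝ᵥ w) • v := by
  rw [Matrix.vecMulVec_mulVec, op_smul_eq_smul]

/-- Applying both products to `v` gives one direction. Conversely the eigenvalue is real, so `star
v` is a left eigenvector with the same eigenvalue. -/
theorem mul_vecMulVec_star_comm_iff {A : Matrix ι ι ℂ} (hA : A.IsHermitian) {v : ι → ℂ}
    (hv : v ≠ 0) :
    A * Matrix.vecMulVec v (star v) = Matrix.vecMulVec v (star v) * A ↔ IsEigenvector A v := by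
  constructor
  · intro h
    have e := congrArg (· *ᵥ v) h
    simp only [← Matrix.mulVec_mulVec, vecMulVec_star_mulVec, Matrix.mulVec_smul] at e
    have h0 := star_dotProduct_self_ne_zero hv
    refine ⟨(star v ⬝ᵥ v)⁻¹ * (star v ⬝ᵥ A *ᵥ v), ?_⟩
    rw [mul_smul, ← e, smul_smul, inv_mul_cancel₀ h0, one_smul]
  · rintro ⟨c, hc⟩
    have h1 : star v ᵥ* A = c • star v := by
      have := congrArg star hc
      rwa [Matrix.star_mulVec, hA.eq, star_smul, hA.star_eq_of_mulVec_eq_smul hv hc] at this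
    rw [Matrix.mul_vecMulVec, Matrix.vecMulVec_mul, hc, h1, Matrix.smul_vecMulVec,
      Matrix.vecMulVec_smul]

theorem isEigenvector_vecMulVec_star_iff {v w : ι → ℂ} :
    IsEigenvector (Matrix.vecMulVec v (star v)) w ↔ star v ⬝ᵥ w = 0 ∨ ∃ c : ℂ, w = c • v := by
  constructor
  · rintro ⟨c, hc⟩
    rw [vecMulVec_star_mulVec] at hc
    refine or_iff_not_imp_left.2 fun h => ?_
    by_cases hc0 : c = 0
    · have : v = 0 := by simpa [hc0, h] using hc
      simp [this] at h
    · exact ⟨c⁻¹ * (star v ⬝ᵥ w), by rw [mul_smul, hc, smul_smul, inv_mul_cancel₀ hc0, one_smul]⟩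
  · rintro (h | ⟨c, rfl⟩)
    · exact ⟨0, by rw [vecMulVec_star_mulVec, h, zero_smul, zero_smul]⟩
    · exact ⟨star v ⬝ᵥ v, by
        rw [vecMulVec_star_mulVec, dotProduct_smul, smul_smul, smul_eq_mul, mul_comm]⟩

theorem mulVec_eq_smul_of_isEigenvector_add {B : Matrix ι ι ℂ} {w y : ι → ℂ} {β : ℂ}
    (hy : B *ᵥ y = β • y) (hy0 : y ≠ 0) (hw : IsEigenvector B w) (hwy : IsEigenvector B (w + y)) :
    B *ᵥ w = β • w := by
  obtain ⟨γ, hγ⟩ := hw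
  obtain ⟨δ, hδ⟩ := hwy
  rw [Matrix.mulVec_add, hγ, hy, smul_add] at hδ
  have e : (γ - δ) • w = (δ - β) • y := by
    rw [sub_smul, sub_smul, sub_eq_sub_iff_add_eq_add, hδ, add_comm]
  by_cases h : γ - δ = 0
  · rw [h, zero_smul, eq_comm, smul_eq_zero, or_iff_left hy0] at e
    rw [hγ, sub_eq_zero.1 h, sub_eq_zero.1 e]
  · have hwy : w = ((γ - δ)⁻¹ * (δ - β)) • y := by
      rw [mul_smul, ← e, smul_smul, inv_mul_cancel₀ h, one_smul]
    rw [hwy, Matrix.mulVec_smul, hy, smul_comm]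

variable [DecidableEq ι]

theorem isEigenvector_conj_iff {U : Matrix ι ι ℂ} (hU : U ∈ Matrix.unitaryGroup ι ℂ)
    (A : Matrix ι ι ℂ) (v : ι → ℂ) :
    IsEigenvector (Uᴴ * A * U) v ↔ IsEigenvector A (U *ᵥ v) := by
  have h1 : Uᴴ * U = 1 := Matrix.mem_unitaryGroup_iff'.1 hU
  have h2 : U * Uᴴ = 1 := Matrix.mem_unitaryGroup_iff.1 hU
  refine exists_congr fun c => ⟨fun h => ?_, fun h => ?_⟩
  · have := congrArg (U *ᵥ ·) h
    simp only [Matrix.mulVec_mulVec, ← Matrix.mul_assoc, h2, Matrix.one_mul,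
      Matrix.mulVec_smul] at this
    rwa [Matrix.mulVec_mulVec]
  · rw [← Matrix.mulVec_mulVec, ← Matrix.mulVec_mulVec, h, Matrix.mulVec_smul,
      Matrix.mulVec_mulVec, h1, Matrix.one_mulVec]

/-- The matrix with eigenvectors the columns of `U` and eigenvalues `p`. -/
def conjDiagonal (U : Matrix ι ι ℂ) (p : ι → ℝ) : Matrix ι ι ℂ :=
  U * Matrix.diagonal (fun i => (p i : ℂ)) * Uᴴ

theorem isHermitian_conjDiagonal (U : Matrix ι ι ℂ) (p : ι → ℝ) :
    (conjDiagonal U p).IsHermitian := by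
  refine Matrix.isHermitian_mul_mul_conjTranspose U ?_
  rw [Matrix.IsHermitian, Matrix.diagonal_conjTranspose]
  congr 1
  funext i
  exact Complex.conj_ofReal _

theorem Matrix.IsHermitian.cfc_eq_conjDiagonal {A : Matrix ι ι ℂ} (hA : A.IsHermitian)
    (f : ℝ → ℝ) : cfc f A = conjDiagonal hA.eigenvectorUnitary (f ∘ hA.eigenvalues) := by
  rw [hA.cfc_eq]
  rfl

theorem Matrix.IsHermitian.eq_conjDiagonal {A : Matrix ι ι ℂ} (hA : A.IsHermitian) :
    A = conjDiagonal hA.eigenvectorUnitary hA.eigenvalues :=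
  hA.spectral_theorem

/-- In the basis `U`, the `(i, j)` entry of the commutator is that of `X` times `p j - p i`. -/
theorem mul_conjDiagonal_comm_iff {U : Matrix ι ι ℂ} (hU : U ∈ Matrix.unitaryGroup ι ℂ)
    (p : ι → ℝ) (X : Matrix ι ι ℂ) :
    X * conjDiagonal U p = conjDiagonal U p * X ↔
      ∀ i j, p i ≠ p j → (Uᴴ * X * U) i j = 0 := by
  have h1 : Uᴴ * U = 1 := Matrix.mem_unitaryGroup_iff'.1 hU
  have h2 : U * Uᴴ = 1 := Matrix.mem_unitaryGroup_iff.1 hU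
  obtain ⟨Y, hY⟩ : ∃ Y, Y = Uᴴ * X * U := ⟨_, rfl⟩
  have hX : X = U * Y * Uᴴ := by
    rw [hY]
    simp only [Matrix.mul_assoc, h2, Matrix.mul_one]
    rw [← Matrix.mul_assoc, h2, Matrix.one_mul]
  obtain ⟨D, hD⟩ : ∃ D, D = Matrix.diagonal fun i => (p i : ℂ) := ⟨_, rfl⟩
  have key : X * conjDiagonal U p = conjDiagonal U p * X ↔ Y * D = D * Y := by
    have e : ∀ A B : Matrix ι ι ℂ, U * A * Uᴴ * (U * B * Uᴴ) = U * (A * B) * Uᴴ := fun A B => by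
      simp only [Matrix.mul_assoc]
      rw [← Matrix.mul_assoc Uᴴ U, h1, Matrix.one_mul]
    rw [conjDiagonal, ← hD, hX, e, e]
    refine ⟨fun h => ?_, fun h => by rw [h]⟩
    have h' := congrArg (fun Z => Uᴴ * Z * U) h
    simp only [Matrix.mul_assoc, h1, Matrix.mul_one] at h'
    simpa only [← Matrix.mul_assoc, h1, Matrix.one_mul] using h'
  rw [key, ← hY, ← Matrix.ext_iff]
  refine forall_congr' fun i => forall_congr' fun j => ?_
  rw [hD, Matrix.mul_diagonal, Matrix.diagonal_mul, mul_comm, ← sub_eq_zero, ← sub_mul,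
    mul_eq_zero, sub_eq_zero, Complex.ofReal_inj, eq_comm, or_iff_not_imp_left]

theorem eq_of_isEigenvector_diagonal {p : ι → ℂ} {i j : ι} (hij : i ≠ j)
    (h : IsEigenvector (Matrix.diagonal p) (Pi.single i 1 + Pi.single j 1)) : p i = p j := by
  obtain ⟨c, hc⟩ := h
  have hi := congrFun hc i
  have hj := congrFun hc j
  simp [Matrix.mulVec_diagonal, hij] at hi
  simp [Matrix.mulVec_diagonal, hij.symm] at hj
  rw [hi, hj]

theorem isEigenvector_diagonal_add {p : ι → ℂ} {i j : ι} (h : p i = p j) :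
    IsEigenvector (Matrix.diagonal p) (Pi.single i 1 + Pi.single j 1) := by
  refine ⟨p i, ?_⟩
  rw [Matrix.mulVec_add, Matrix.diagonal_mulVec_single, Matrix.diagonal_mulVec_single, smul_add,
    ← Pi.single_smul, ← Pi.single_smul, h, smul_eq_mul]

theorem conj_conjDiagonal {U : Matrix ι ι ℂ} (hU : U ∈ Matrix.unitaryGroup ι ℂ) (p : ι → ℝ) :
    Uᴴ * conjDiagonal U p * U = Matrix.diagonal fun i => (p i : ℂ) := by
  have h1 : Uᴴ * U = 1 := Matrix.mem_unitaryGroup_iff'.1 hU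
  rw [conjDiagonal, Matrix.mul_assoc U, ← Matrix.mul_assoc, h1, Matrix.one_mul, Matrix.mul_assoc,
    h1, Matrix.mul_one]

theorem isEigenvector_conjDiagonal_iff {U : Matrix ι ι ℂ} (hU : U ∈ Matrix.unitaryGroup ι ℂ)
    (p : ι → ℝ) (v : ι → ℂ) :
    IsEigenvector (conjDiagonal U p) (U *ᵥ v) ↔
      IsEigenvector (Matrix.diagonal fun i => (p i : ℂ)) v := by
  rw [← isEigenvector_conj_iff hU, conj_conjDiagonal hU]

/-- The columns of `U` are eigenvectors of `B`, so `B` is diagonal in that basis. If `a i = a j`,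
the sum of the two columns is an eigenvector too, which forces `b i = b j`. -/
theorem exists_eq_conjDiagonal {U : Matrix ι ι ℂ} (hU : U ∈ Matrix.unitaryGroup ι ℂ) (a : ι → ℝ)
    {B : Matrix ι ι ℂ} (hB : B.IsHermitian)
    (h : ∀ v, IsEigenvector (conjDiagonal U a) v → IsEigenvector B v) :
    ∃ b : ι → ℝ, B = conjDiagonal U b ∧ ∀ i j, a i = a j → b i = b j := by
  have h2 : U * Uᴴ = 1 := Matrix.mem_unitaryGroup_iff.1 hU
  obtain ⟨C, hC⟩ : ∃ C, C = Uᴴ * B * U := ⟨_, rfl⟩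
  have hBC : B = U * C * Uᴴ := by
    rw [hC]
    simp only [Matrix.mul_assoc, h2, Matrix.mul_one]
    rw [← Matrix.mul_assoc, h2, Matrix.one_mul]
  have hCh : C.IsHermitian := hC ▸ Matrix.isHermitian_conjTranspose_mul_mul U hB
  have hCe : ∀ v, IsEigenvector (Matrix.diagonal fun i => (a i : ℂ)) v → IsEigenvector C v :=
    fun v hv => by
      rw [hC, isEigenvector_conj_iff hU]
      exact h _ ((isEigenvector_conjDiagonal_iff hU a v).2 hv)
  have hCd : C = Matrix.diagonal fun i => (((C i i).re : ℝ) : ℂ) := by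
    ext i j
    by_cases hij : i = j
    · subst hij
      rw [Matrix.diagonal_apply_eq]
      exact (hCh.coe_re_apply_self i).symm
    · rw [Matrix.diagonal_apply_ne _ hij]
      obtain ⟨c, hc⟩ := hCe (Pi.single j 1) ⟨a j, by
        rw [Matrix.diagonal_mulVec_single, ← Pi.single_smul, smul_eq_mul]⟩
      simpa [hij] using congrFun hc i
  refine ⟨fun i => (C i i).re, ?_, fun i j hij => ?_⟩
  · rw [conjDiagonal, ← hCd, hBC]
  · by_cases hne : i = j
    · rw [hne]
    have e := hCe _ (isEigenvector_diagonal_add (p := fun i => (a i : ℂ)) (i := i) (j := j)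
      (by rw [hij]))
    rw [hCd] at e
    exact Complex.ofReal_injective
      (eq_of_isEigenvector_diagonal (p := fun i => ((C i i).re : ℂ)) hne e)

theorem mul_comm_of_isEigenvector_imp {A B X : Matrix ι ι ℂ} (hA : A.IsHermitian)
    (hB : B.IsHermitian) (h : ∀ v, IsEigenvector A v → IsEigenvector B v) (hX : X * A = A * X) :
    X * B = B * X := by
  have hU : (hA.eigenvectorUnitary : Matrix ι ι ℂ) ∈ Matrix.unitaryGroup ι ℂ :=
    hA.eigenvectorUnitary.2
  rw [hA.eq_conjDiagonal] at h hX
  obtain ⟨b, rfl, hb⟩ := exists_eq_conjDiagonal hU _ hB h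
  rw [mul_conjDiagonal_comm_iff hU] at hX ⊢
  exact fun i j hij => hX i j fun e => hij (hb i j e)

/-- Hermitian matrices with the same eigenvectors are injective functions of each other. -/
theorem exists_eq_cfc_of_isEigenvector_iff {A B : Matrix ι ι ℂ} (hA : A.IsHermitian)
    (hB : B.IsHermitian) (h : ∀ v, IsEigenvector A v ↔ IsEigenvector B v) :
    ∃ f : ℝ → ℝ, Set.InjOn f (spectrum ℝ A) ∧ B = cfc f A := by
  have hU : (hA.eigenvectorUnitary : Matrix ι ι ℂ) ∈ Matrix.unitaryGroup ι ℂ :=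
    hA.eigenvectorUnitary.2
  obtain ⟨b, hBb, hb⟩ := exists_eq_conjDiagonal hU hA.eigenvalues hB
    (by rw [← hA.eq_conjDiagonal]; exact fun v => (h v).1)
  obtain ⟨a, ha, hab⟩ := exists_eq_conjDiagonal hU b hA (by rw [← hBb]; exact fun v => (h v).2)
  -- Both diagonalise `A` by the same unitary, hence agree index by index.
  have haa : a = hA.eigenvalues := by
    have e := conj_conjDiagonal hU a
    rw [← ha] at e
    nth_rewrite 2 [hA.eq_conjDiagonal] at e
    rw [conj_conjDiagonal hU] at e
    funext i
    exact Complex.ofReal_injective (congrFun (Matrix.diagonal_injective e) i).symm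
  have hf : ∀ i, Function.extend hA.eigenvalues b 0 (hA.eigenvalues i) = b i :=
    fun i => Function.FactorsThrough.extend_apply (fun i j hij => hb i j hij) _ i
  refine ⟨Function.extend hA.eigenvalues b 0, ?_, ?_⟩
  · rw [hA.spectrum_real_eq_range_eigenvalues]
    rintro _ ⟨i, rfl⟩ _ ⟨j, rfl⟩ hij
    rw [hf, hf] at hij
    rw [← haa]
    exact hab i j hij
  · rw [hA.cfc_eq_conjDiagonal, hBb]
    congr 1
    funext i
    exact (hf i).symm

end Eigenvectors

/-! ### Rank one matrices and orthogonality in terms of commutation -/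

section OneBlock

/-- `p` adds at most one block: the closure of `{a, p}` under double commutation has nothing
strictly between `a` and `{a, p}`, whenever `a` commutes with `p`. -/
def AddsOneBlock {α : Type*} (r : α → α → Prop) (p : α) : Prop :=
  ∀ a, r a p → ∀ b, (∀ x, r x b → r x a) → (∀ x, r x a → r x p → r x b) →
    (∀ x, r x a → r x b) ∨ (∀ x, r x b → r x p)

theorem addsOneBlock_map_iff {α β : Type*} {r : α → α → Prop} {s : β → β → Prop} {φ : α → β}
    (hφ : Function.Surjective φ) (h : ∀ a b, r a b ↔ s (φ a) (φ b)) (p : α) :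
    AddsOneBlock s (φ p) ↔ AddsOneBlock r p := by
  simp only [AddsOneBlock, hφ.forall, ← h]

/-- Combinatorial core of the converse: functions stand for their partitions into level sets, and
the conclusion is that `p` separates a single point from all the others. -/
theorem exists_isolated_of_addsOneBlock {ι : Type*} {p : ι → ℝ} (hp : ∃ i j, p i ≠ p j)
    (h : ∀ a b : ι → ℝ, (∀ i j, b i = b j → a i = a j) →
      (∀ i j, a i = a j → p i = p j → b i = b j) →
      (∀ i j, a i = a j → b i = b j) ∨ (∀ i j, b i = b j → p i = p j)) :
    ∃ i, ∀ j, j ≠ i → p j ≠ p i ∧ ∀ k, k ≠ i → p j = p k := by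
  classical
  obtain ⟨i, j, hij⟩ := hp
  have htwo : ∀ k l, p k ≠ p i → p l ≠ p i → p k = p l := by
    intro k l hk hl
    -- With a third value of `p`, the indicator of one level set would lie strictly between the
    -- trivial partition and that of `p`.
    rcases h (fun _ => 0) (fun m => if p m = p i then 1 else 0) (fun _ _ _ => rfl)
      (fun m m' _ e => by simp only [e]) with h | h
    · have := h i j rfl
      simp [hij.symm] at this
    · exact h k l (by simp [hk, hl])
  by_contra! hcon
  obtain ⟨i', hi', hi''⟩ : ∃ i', i' ≠ i ∧ p i' = p i := by
    obtain ⟨k, hk, hk'⟩ := hcon i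
    by_contra! hne
    obtain ⟨l, hl, hl'⟩ := hk' (hne k hk)
    exact hl' (htwo k l (hne k hk) (hne l hl))
  obtain ⟨j', hj', hj''⟩ : ∃ j', j' ≠ j ∧ p j' = p j := by
    obtain ⟨k, hk, hk'⟩ := hcon j
    by_contra! hne
    have hi : ∀ m, m ≠ j → p m = p i := fun m hm => by
      by_contra hmi
      exact hne m hm (htwo m j hmi hij.symm)
    obtain ⟨l, hl, hl'⟩ := hk' (hne k hk)
    exact hl' ((hi k hk).trans (hi l hl).symm)
  have hne : i ≠ j := fun e => hij (congrArg p e)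
  have hi'j : i' ≠ j := fun e => hij (by rw [← hi'', e])
  have hj'i : j' ≠ i := fun e => hij (by rw [← hj'', e])
  have hji := Ne.symm hij
  -- If the levels of `i` and `j` both had another point, splitting the block `{i, j}` but not its
  -- complement, which contains `i'` and `j'`, would be strictly intermediate.
  rcases h (fun m => if m = i ∨ m = j then 1 else 0)
    (fun m => if m = i then 1 else if m = j then 2 else 0)
    (fun m m' => by
      by_cases h1 : m = i <;> by_cases h2 : m = j <;> by_cases h3 : m' = i <;>
        by_cases h4 : m' = j <;> simp_all)
    (fun m m' => by
      by_cases h1 : m = i <;> by_cases h2 : m = j <;> by_cases h3 : m' = i <;>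
        by_cases h4 : m' = j <;> simp_all) with h | h
  · have := h i j (by simp)
    simp [hne.symm] at this
  · have := h i' j' (by simp [hi', hi'j, hj', hj'i])
    exact hij (by rw [← hi'', ← hj'', this])

variable {ι : Type*} [Fintype ι]

/-- Commutation of hermitian matrices. -/
def HermitianCommute (A B : selfAdjoint (Matrix ι ι ℂ)) : Prop :=
  (A : Matrix ι ι ℂ) * (B : Matrix ι ι ℂ) = (B : Matrix ι ι ℂ) * (A : Matrix ι ι ℂ)

theorem HermitianCommute.symm {A B : selfAdjoint (Matrix ι ι ℂ)} (h : HermitianCommute A B) :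
    HermitianCommute B A :=
  Eq.symm h

theorem hermitianCommute_comm {A B : selfAdjoint (Matrix ι ι ℂ)} :
    HermitianCommute A B ↔ HermitianCommute B A :=
  eq_comm

/-- The hermitian matrix `v v*`. -/
def rankOne (v : ι → ℂ) : selfAdjoint (Matrix ι ι ℂ) :=
  ⟨Matrix.vecMulVec v (star v), isHermitian_vecMulVec_star v⟩

theorem hermitianCommute_rankOne_iff {v : ι → ℂ} (hv : v ≠ 0) (A : selfAdjoint (Matrix ι ι ℂ)) :
    HermitianCommute A (rankOne v) ↔ IsEigenvector (A : Matrix ι ι ℂ) v :=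
  mul_vecMulVec_star_comm_iff A.2 hv

theorem isEigenvector_rankOne_iff {v w : ι → ℂ} :
    IsEigenvector (rankOne v : Matrix ι ι ℂ) w ↔ star v ⬝ᵥ w = 0 ∨ ∃ c : ℂ, w = c • v :=
  isEigenvector_vecMulVec_star_iff

theorem star_dotProduct_eq_zero_comm {v w : ι → ℂ} : star v ⬝ᵥ w = 0 ↔ star w ⬝ᵥ v = 0 := by
  rw [← star_eq_zero, Matrix.star_dotProduct, star_star, dotProduct_comm]

/-- Two linear conditions in dimension at least three have a nonzero common solution. -/
theorem exists_orthogonal_pair (hι : 3 ≤ Fintype.card ι) (v w : ι → ℂ) :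
    ∃ z : ι → ℂ, z ≠ 0 ∧ star v ⬝ᵥ z = 0 ∧ star w ⬝ᵥ z = 0 := by
  have h : LinearMap.ker (Matrix.of ![star v, star w]).mulVecLin ≠ ⊥ :=
    LinearMap.ker_ne_bot_of_finrank_lt (by simp; omega)
  obtain ⟨z, hz, hz0⟩ := Submodule.exists_mem_ne_zero_of_ne_bot h
  refine ⟨z, hz0, ?_, ?_⟩
  · exact congrFun (LinearMap.mem_ker.1 hz) 0
  · exact congrFun (LinearMap.mem_ker.1 hz) 1

theorem not_isEigenvector_rankOne_add {w z : ι → ℂ} (hw : w ≠ 0) (hz : z ≠ 0)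
    (hwz : star w ⬝ᵥ z = 0) : ¬ IsEigenvector (rankOne (w + z) : Matrix ι ι ℂ) w := by
  rw [isEigenvector_rankOne_iff, star_add, add_dotProduct, star_dotProduct_eq_zero_comm.1 hwz,
    add_zero]
  rintro (h | ⟨c, hc⟩)
  · exact star_dotProduct_self_ne_zero hw h
  · have e := congrArg (star z ⬝ᵥ ·) hc
    simp only [dotProduct_smul, dotProduct_add, star_dotProduct_eq_zero_comm.1 hwz, zero_add,
      smul_eq_mul] at e
    rw [zero_eq_mul, or_iff_left (star_dotProduct_self_ne_zero hz)] at e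
    rw [e, zero_smul] at hc
    exact hw hc

theorem exists_not_hermitianCommute_rankOne (hι : 3 ≤ Fintype.card ι) {v : ι → ℂ} (hv : v ≠ 0) :
    ∃ X, ¬ HermitianCommute X (rankOne v) := by
  obtain ⟨z, hz, hvz, -⟩ := exists_orthogonal_pair hι v v
  exact ⟨rankOne (v + z), by
    rw [hermitianCommute_rankOne_iff hv]; exact not_isEigenvector_rankOne_add hv hz hvz⟩

/-- Orthogonality of vectors in terms of commutation of hermitian matrices. -/
theorem star_dotProduct_eq_zero_iff (hι : 3 ≤ Fintype.card ι) {v w : ι → ℂ} (hw : w ≠ 0) :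
    star v ⬝ᵥ w = 0 ↔ HermitianCommute (rankOne v) (rankOne w) ∧
      ∃ A : selfAdjoint (Matrix ι ι ℂ),
        IsEigenvector (A : Matrix ι ι ℂ) v ∧ ¬ IsEigenvector (A : Matrix ι ι ℂ) w := by
  rw [hermitianCommute_rankOne_iff hw, isEigenvector_rankOne_iff]
  constructor
  · intro h
    -- The rank one matrix of `w + z` kills `v`, while `w` is neither orthogonal nor proportional to
    -- `w + z`.
    obtain ⟨z, hz, hvz, hwz⟩ := exists_orthogonal_pair hι v w
    refine ⟨Or.inl h, rankOne (w + z), ?_, not_isEigenvector_rankOne_add hw hz hwz⟩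
    rw [isEigenvector_rankOne_iff, star_dotProduct_eq_zero_comm, dotProduct_add, h, hvz, add_zero]
    exact Or.inl rfl
  · rintro ⟨h | ⟨c, rfl⟩, A, hAv, hAw⟩
    · exact h
    · exact absurd ((isEigenvector_smul_iff _ _ fun hc => hw (by rw [hc, zero_smul])).2 hAv) hAw

variable [DecidableEq ι]

theorem addsOneBlock_rankOne {v : ι → ℂ} (hv : v ≠ 0) :
    AddsOneBlock HermitianCommute (rankOne v) := by
  intro A hAv B h1 h2
  refine or_iff_not_imp_right.2 fun hP => ?_
  push Not at hP
  obtain ⟨X, hXB, hXv⟩ := hP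
  have hvv := star_dotProduct_self_ne_zero hv
  obtain ⟨l, hl⟩ := (hermitianCommute_rankOne_iff hv A).1 hAv
  obtain ⟨β, hβ⟩ := (hermitianCommute_rankOne_iff hv B).1 (h2 _ hAv.symm rfl).symm
  have hXA := h1 X hXB
  rw [hermitianCommute_rankOne_iff hv] at hXv
  have hproj : ∀ z : ι → ℂ, ∃ (a : ℂ) (w : ι → ℂ), z = w + a • v ∧ star v ⬝ᵥ w = 0 := by
    intro z
    refine ⟨(star v ⬝ᵥ z) / (star v ⬝ᵥ v), z - ((star v ⬝ᵥ z) / (star v ⬝ᵥ v)) • v,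
      (sub_add_cancel _ _).symm, ?_⟩
    rw [dotProduct_sub, dotProduct_smul, smul_eq_mul, div_mul_cancel₀ _ hvv, sub_self]
  have hcommv : ∀ {C : selfAdjoint (Matrix ι ι ℂ)} {γ : ℂ}, HermitianCommute X C →
      (C : Matrix ι ι ℂ) *ᵥ v = γ • v →
      (C : Matrix ι ι ℂ) *ᵥ ((X : Matrix ι ι ℂ) *ᵥ v) = γ • ((X : Matrix ι ι ℂ) *ᵥ v) := by
    intro C γ hC hγ
    rw [Matrix.mulVec_mulVec, ← show _ = _ from hC, ← Matrix.mulVec_mulVec, hγ, Matrix.mulVec_smul]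
  -- `X` preserves the eigenspaces of `A` and `B` but moves the line of `v`, so the component `y` of
  -- `X v` orthogonal to `v` is nonzero and shares the eigenvalues of `v`.
  obtain ⟨c, y, hXy, hvy⟩ := hproj ((X : Matrix ι ι ℂ) *ᵥ v)
  have hy0 : y ≠ 0 := fun h => hXv ⟨c, by rw [hXy, h, zero_add]⟩
  have hyX : y = (X : Matrix ι ι ℂ) *ᵥ v - c • v := eq_sub_of_add_eq hXy.symm
  have hAy : (A : Matrix ι ι ℂ) *ᵥ y = l • y := by
    rw [hyX, Matrix.mulVec_sub, hcommv hXA hl, Matrix.mulVec_smul, hl, smul_sub, smul_comm]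
  have hBy : (B : Matrix ι ι ℂ) *ᵥ y = β • y := by
    rw [hyX, Matrix.mulVec_sub, hcommv hXB hβ, Matrix.mulVec_smul, hβ, smul_sub, smul_comm]
  -- For such `z`, the rank one matrix of `z` commutes with both `A` and `rankOne v`, hence with
  -- `B`.
  have hperp : ∀ z, star v ⬝ᵥ z = 0 → IsEigenvector (A : Matrix ι ι ℂ) z →
      IsEigenvector (B : Matrix ι ι ℂ) z := by
    intro z hz hAz
    by_cases hz0 : z = 0
    · rw [hz0]; exact IsEigenvector.zero _
    rw [← hermitianCommute_rankOne_iff hz0] at hAz ⊢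
    refine (h2 _ hAz.symm ?_).symm
    rw [hermitianCommute_comm, hermitianCommute_rankOne_iff hz0]
    exact isEigenvector_rankOne_iff.2 (Or.inl hz)
  intro W hWA
  refine mul_comm_of_isEigenvector_imp A.2 B.2 (fun z hAz => ?_) hWA
  by_cases hvz : star v ⬝ᵥ z = 0
  · exact hperp z hvz hAz
  obtain ⟨l', hl'⟩ := hAz
  have hll : l' = l := by
    have e := Matrix.IsHermitian.star_dotProduct_mulVec A.2 v z
    rw [hl', hl, star_smul, Matrix.IsHermitian.star_eq_of_mulVec_eq_smul A.2 hv hl,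
      dotProduct_smul, smul_dotProduct] at e
    exact mul_right_cancel₀ hvz e
  obtain ⟨a, w, rfl, hvw⟩ := hproj z
  have hAw : (A : Matrix ι ι ℂ) *ᵥ w = l • w := by
    rw [hll, Matrix.mulVec_add, Matrix.mulVec_smul, hl, smul_add, smul_comm a l] at hl'
    exact add_right_cancel hl'
  -- Comparison with `y`: since `w`, `y` and `w + y` are all eigenvectors of `B`, `w` has the
  -- eigenvalue `β` of `y`, which is that of `v`.
  have hBw : (B : Matrix ι ι ℂ) *ᵥ w = β • w :=
    mulVec_eq_smul_of_isEigenvector_add hBy hy0 (hperp w hvw ⟨l, hAw⟩)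
      (hperp (w + y) (by rw [dotProduct_add, hvw, hvy, add_zero])
        ⟨l, by rw [Matrix.mulVec_add, hAw, hAy, smul_add]⟩)
  exact ⟨β, by rw [Matrix.mulVec_add, Matrix.mulVec_smul, hBw, hβ, smul_add, smul_comm]⟩

theorem mulVec_ne_zero_of_mem_unitaryGroup {U : Matrix ι ι ℂ} (hU : U ∈ Matrix.unitaryGroup ι ℂ)
    {v : ι → ℂ} (hv : v ≠ 0) : U *ᵥ v ≠ 0 := fun h => hv (by
  have h1 : Uᴴ * U = 1 := Matrix.mem_unitaryGroup_iff'.1 hU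
  rw [← Matrix.one_mulVec v, ← h1, ← Matrix.mulVec_mulVec, h, Matrix.mulVec_zero])

/-- The test matrix is the rank one matrix of the sum of columns `i` and `j`. -/
theorem eq_of_commutant_conjDiagonal_le {U : Matrix ι ι ℂ} (hU : U ∈ Matrix.unitaryGroup ι ℂ)
    {a b : ι → ℝ}
    (h : ∀ X : selfAdjoint (Matrix ι ι ℂ), HermitianCommute X ⟨_, isHermitian_conjDiagonal U a⟩ →
      HermitianCommute X ⟨_, isHermitian_conjDiagonal U b⟩) {i j : ι} (hij : a i = a j) :
    b i = b j := by
  by_cases hne : i = j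
  · rw [hne]
  have hv : U *ᵥ (Pi.single i 1 + Pi.single j 1) ≠ 0 :=
    mulVec_ne_zero_of_mem_unitaryGroup hU fun e => by simpa [hne] using congrFun e i
  have h' := h (rankOne (U *ᵥ (Pi.single i 1 + Pi.single j 1)))
  rw [hermitianCommute_comm, hermitianCommute_comm (A := rankOne _),
    hermitianCommute_rankOne_iff hv, hermitianCommute_rankOne_iff hv,
    isEigenvector_conjDiagonal_iff hU, isEigenvector_conjDiagonal_iff hU] at h'
  exact Complex.ofReal_injective (eq_of_isEigenvector_diagonal (p := fun i => (b i : ℂ)) hne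
    (h' (isEigenvector_diagonal_add (p := fun i => (a i : ℂ)) (by rw [hij]))))

theorem isEigenvector_single_iff {Y : Matrix ι ι ℂ} {i : ι} :
    IsEigenvector Y (Pi.single i 1) ↔ ∀ j, j ≠ i → Y j i = 0 := by
  rw [IsEigenvector, Matrix.mulVec_single_one]
  constructor
  · rintro ⟨c, hc⟩ j hj
    simpa [hj] using congrFun hc j
  · refine fun h => ⟨Y i i, funext fun j => ?_⟩
    by_cases hj : j = i
    · subst hj; simp
    · simp [hj, h j hj]

/-- A nonscalar hermitian matrix satisfying `AddsOneBlock` has the commutant of a rank one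
projection. -/
theorem exists_commutant_eq_of_addsOneBlock {P : selfAdjoint (Matrix ι ι ℂ)}
    (hP : ∃ X, ¬ HermitianCommute X P) (h : AddsOneBlock HermitianCommute P) :
    ∃ w : ι → ℂ, w ≠ 0 ∧
      ∀ X : selfAdjoint (Matrix ι ι ℂ),
        HermitianCommute X P ↔ IsEigenvector (X : Matrix ι ι ℂ) w := by
  have hPh : (P : Matrix ι ι ℂ).IsHermitian := P.2
  obtain ⟨U, hU, p, hp⟩ : ∃ U ∈ Matrix.unitaryGroup ι ℂ, ∃ p : ι → ℝ,
      P = ⟨conjDiagonal U p, isHermitian_conjDiagonal U p⟩ :=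
    ⟨_, hPh.eigenvectorUnitary.2, hPh.eigenvalues, Subtype.ext hPh.eq_conjDiagonal⟩
  have hcomm : ∀ (X : selfAdjoint (Matrix ι ι ℂ)) (q : ι → ℝ),
      HermitianCommute X ⟨_, isHermitian_conjDiagonal U q⟩ ↔
        ∀ i j, q i ≠ q j → (Uᴴ * (X : Matrix ι ι ℂ) * U) i j = 0 := fun X q =>
    mul_conjDiagonal_comm_iff hU q X
  subst hp
  have hp : ∃ i j, p i ≠ p j := by
    obtain ⟨X, hX⟩ := hP
    rw [hcomm] at hX
    push Not at hX
    obtain ⟨i, j, hij, -⟩ := hX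
    exact ⟨i, j, hij⟩
  -- Restricting `AddsOneBlock` to matrices diagonal in the basis `U` turns commutants into
  -- partitions of the index set.
  obtain ⟨i, hi⟩ := exists_isolated_of_addsOneBlock hp fun a b hba habp => by
    refine (h ⟨_, isHermitian_conjDiagonal U a⟩ ?_ ⟨_, isHermitian_conjDiagonal U b⟩ ?_ ?_).imp
      (fun h' i j => eq_of_commutant_conjDiagonal_le hU h')
      (fun h' i j => eq_of_commutant_conjDiagonal_le hU h')
    · rw [hcomm]
      intro i j hij
      change (Uᴴ * conjDiagonal U a * U) i j = 0
      rw [conj_conjDiagonal hU, Matrix.diagonal_apply_ne _ fun e => hij (by rw [e])]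
    · intro X
      rw [hcomm, hcomm]
      exact fun hX i j hij => hX i j fun e => hij (hba i j e)
    · intro X
      rw [hcomm, hcomm, hcomm]
      intro hXa hXp i j hij
      by_cases ha : a i = a j
      · exact hXp i j fun e => hij (habp i j ha e)
      · exact hXa i j ha
  refine ⟨U *ᵥ Pi.single i 1, mulVec_ne_zero_of_mem_unitaryGroup hU (by simp), fun X => ?_⟩
  rw [hcomm, ← isEigenvector_conj_iff hU, isEigenvector_single_iff]
  have hY : (Uᴴ * (X : Matrix ι ι ℂ) * U).IsHermitian :=
    Matrix.isHermitian_conjTranspose_mul_mul U X.2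
  refine ⟨fun hX j hj => hX j i (hi j hj).1, fun hX j k hjk => ?_⟩
  by_cases hj : j = i
  · subst hj
    rw [← hY.apply, hX k fun e => hjk (by rw [e]), star_zero]
  by_cases hk : k = i
  · subst hk
    exact hX j hj
  exact absurd ((hi j hj).2 k hk) hjk

end OneBlock

/-! ### Transposes and the main theorem -/

/-- For hermitian `A` the transpose is the entrywise conjugate, so its eigenvectors are the
conjugates of those of `A`. -/
theorem isEigenvector_transpose_iff {ι : Type*} [Fintype ι] {A : Matrix ι ι ℂ}
    (hA : A.IsHermitian) (v : ι → ℂ) : IsEigenvector Aᵀ v ↔ IsEigenvector A (star v) := by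
  have h : ∀ (B : Matrix ι ι ℂ), B.IsHermitian → ∀ w, IsEigenvector B w →
      IsEigenvector Bᵀ (star w) := by
    rintro B hB w ⟨c, hc⟩
    refine ⟨star c, ?_⟩
    rw [Matrix.mulVec_transpose, ← star_smul, ← hc, Matrix.star_mulVec, hB.eq]
  refine ⟨fun hv => ?_, fun hv => ?_⟩
  · simpa using h Aᵀ hA.transpose v hv
  · simpa using h A hA _ hv

theorem spectrum_real_transpose {ι : Type*} [Fintype ι] [DecidableEq ι] (A : Matrix ι ι ℂ) :
    spectrum ℝ Aᵀ = spectrum ℝ A := by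
  ext r
  have h : algebraMap ℝ (Matrix ι ι ℂ) r - Aᵀ = (algebraMap ℝ (Matrix ι ι ℂ) r - A)ᵀ := by
    rw [Matrix.transpose_sub, Matrix.algebraMap_eq_diagonal, Matrix.diagonal_transpose]
  rw [spectrum.mem_iff, spectrum.mem_iff, h, Matrix.isUnit_transpose]

theorem eq_conj_of_conjTranspose_mul_mul_eq {ι : Type*} [Fintype ι] [DecidableEq ι]
    {U A B : Matrix ι ι ℂ} (hU : U ∈ Matrix.unitaryGroup ι ℂ) (h : Uᴴ * A * U = B) :
    A = U * B * Uᴴ := by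
  have h2 : U * Uᴴ = 1 := Matrix.mem_unitaryGroup_iff.1 hU
  rw [← h, Matrix.mul_assoc, Matrix.mul_assoc, Matrix.mul_assoc, h2, Matrix.mul_one,
    ← Matrix.mul_assoc, h2, Matrix.one_mul]

/-- Bijections of the hermitian `n × n` matrices preserving commutativity in both directions.
`selfAdjoint (Matrix (Fin n) (Fin n) ℂ)` is the set of hermitian matrices (`star A = Aᴴ`), `f A` is
used only through its values on the (finite, real) spectrum of `A`, and `cfc g B` is the matrix
`g(B)` of the functional calculus. Note that `Aᵀ` is hermitian with the same spectrum as `A`. -/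
theorem theorem4p2 (n : ℕ) (hn : 3 ≤ n)
    (φ : selfAdjoint (Matrix (Fin n) (Fin n) ℂ) → selfAdjoint (Matrix (Fin n) (Fin n) ℂ))
    (hφ : Function.Bijective φ)
    (hcomm : ∀ A B : selfAdjoint (Matrix (Fin n) (Fin n) ℂ),
      (A : Matrix (Fin n) (Fin n) ℂ) * (B : Matrix (Fin n) (Fin n) ℂ) =
          (B : Matrix (Fin n) (Fin n) ℂ) * (A : Matrix (Fin n) (Fin n) ℂ) ↔
        (φ A : Matrix (Fin n) (Fin n) ℂ) * (φ B : Matrix (Fin n) (Fin n) ℂ) =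
          (φ B : Matrix (Fin n) (Fin n) ℂ) * (φ A : Matrix (Fin n) (Fin n) ℂ)) :
    ∃ U ∈ Matrix.unitaryGroup (Fin n) ℂ,
      ∃ f : selfAdjoint (Matrix (Fin n) (Fin n) ℂ) → ℝ → ℝ,
        (∀ A, Set.InjOn (f A) (spectrum ℝ (A : Matrix (Fin n) (Fin n) ℂ))) ∧
        ((∀ A, (φ A : Matrix (Fin n) (Fin n) ℂ) =
            U * cfc (f A) (A : Matrix (Fin n) (Fin n) ℂ) * Uᴴ) ∨
          (∀ A, (φ A : Matrix (Fin n) (Fin n) ℂ) =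
            U * cfc (f A) ((A : Matrix (Fin n) (Fin n) ℂ)ᵀ) * Uᴴ)) := by
  have hc : ∀ A B, HermitianCommute A B ↔ HermitianCommute (φ A) (φ B) := hcomm
  have hι : 3 ≤ Fintype.card (Fin n) := by rwa [Fintype.card_fin]
  have hex : ∀ v : Fin n → ℂ, v ≠ 0 → ∃ w : Fin n → ℂ, w ≠ 0 ∧
      ∀ X : selfAdjoint (Matrix (Fin n) (Fin n) ℂ),
        HermitianCommute X (φ (rankOne v)) ↔ IsEigenvector (X : Matrix (Fin n) (Fin n) ℂ) w :=
    fun v hv => exists_commutant_eq_of_addsOneBlock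
      (by
        obtain ⟨X, hX⟩ := exists_not_hermitianCommute_rankOne hι hv
        exact ⟨φ X, by rwa [← hc]⟩)
      ((addsOneBlock_map_iff hφ.surjective hc _).2 (addsOneBlock_rankOne hv))
  choose! ψ hψ0 hψ using hex
  -- `φ (rankOne v)` has the commutant of `rankOne (ψ v)`, though it need not have rank one.
  have heig : ∀ (A : selfAdjoint (Matrix (Fin n) (Fin n) ℂ)) v, v ≠ 0 → (IsEigenvector (A : Matrix (Fin n) (Fin n) ℂ) v ↔
      IsEigenvector (φ A : Matrix (Fin n) (Fin n) ℂ) (ψ v)) := fun A v hv => by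
    rw [← hψ v hv, ← hc, hermitianCommute_rankOne_iff hv]
  have horth : ∀ x y, x ≠ 0 → y ≠ 0 → (star x ⬝ᵥ y = 0 ↔ star (ψ x) ⬝ᵥ ψ y = 0) := by
    intro x y hx hy
    rw [star_dotProduct_eq_zero_iff hι hy, star_dotProduct_eq_zero_iff hι (hψ0 y hy)]
    refine and_congr ?_ ?_
    · rw [hc, hψ y hy, ← hermitianCommute_rankOne_iff (hψ0 y hy), hermitianCommute_comm, hψ x hx,
        ← hermitianCommute_rankOne_iff (hψ0 x hx), hermitianCommute_comm]
    -- Surjectivity of `φ` lets the separating matrix be sought among the `φ A`.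
    · refine Iff.trans (exists_congr fun A => ?_) hφ.surjective.exists.symm
      rw [heig A x hx, heig A y hy]
  obtain ⟨U, hU, h⟩ := exists_unitary_of_orthogonality_preserving
    (a := (⟨0, by omega⟩ : Fin n)) (b := ⟨1, by omega⟩) (c := ⟨2, by omega⟩)
    (by simp) (by simp) (by simp) ψ hψ0 horth
  have hherm : ∀ A, (Uᴴ * (φ A : Matrix (Fin n) (Fin n) ℂ) * U).IsHermitian := fun A =>
    Matrix.isHermitian_conjTranspose_mul_mul U (φ A).2
  refine ⟨U, hU, ?_⟩
  rcases h with h | h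
  · have key : ∀ A : selfAdjoint (Matrix (Fin n) (Fin n) ℂ),
        ∃ f : ℝ → ℝ, Set.InjOn f (spectrum ℝ (A : Matrix (Fin n) (Fin n) ℂ)) ∧
          Uᴴ * (φ A : Matrix (Fin n) (Fin n) ℂ) * U = cfc f (A : Matrix (Fin n) (Fin n) ℂ) :=
      fun A => exists_eq_cfc_of_isEigenvector_iff A.2 (hherm A) fun v => by
        by_cases hv : v = 0
        · simp [hv, IsEigenvector.zero]
        obtain ⟨k, hk, hkv⟩ := h v hv
        rw [isEigenvector_conj_iff hU, heig A v hv, hkv, isEigenvector_smul_iff _ _ hk]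
    choose f hf hfA using key
    exact ⟨f, hf, Or.inl fun A => eq_conj_of_conjTranspose_mul_mul_eq hU (hfA A)⟩
  · have key : ∀ A : selfAdjoint (Matrix (Fin n) (Fin n) ℂ),
        ∃ f : ℝ → ℝ, Set.InjOn f (spectrum ℝ (A : Matrix (Fin n) (Fin n) ℂ)ᵀ) ∧
          Uᴴ * (φ A : Matrix (Fin n) (Fin n) ℂ) * U = cfc f (A : Matrix (Fin n) (Fin n) ℂ)ᵀ :=
      fun A => exists_eq_cfc_of_isEigenvector_iff (Matrix.IsHermitian.transpose A.2) (hherm A)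
        fun v => by
        by_cases hv : v = 0
        · simp [hv, IsEigenvector.zero]
        -- Evaluating at `star v` cancels the conjugation in the antiunitary case against that of
        -- the transpose.
        obtain ⟨k, hk, hkv⟩ := h (star v) (star_ne_zero.2 hv)
        rw [isEigenvector_conj_iff hU, isEigenvector_transpose_iff A.2,
          heig A _ (star_ne_zero.2 hv), hkv, isEigenvector_smul_iff _ _ hk, star_star]
    choose f hf hfA using key
    exact ⟨f, fun A => spectrum_real_transpose (A : Matrix (Fin n) (Fin n) ℂ) ▸ hf A,
      Or.inr fun A => eq_conj_of_conjTranspose_mul_mul_eq hU (hfA A)⟩
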